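/- For $x=(x_n)_{n\ge1}\in\mathbb C^{\mathbb N}$ put $|x|=(|x_n|)_n$ and let $C(x)=\bigl(\tfrac1n\sum_{k=1}^n x_k\bigr)_n$ be the Cesàro operator. For $1<q<\infty$ let $\mathrm{ces}(q)=\{x\in\mathbb C^{\mathbb N}: C(|x|)\in\ell_q\}$ with norm $\|x\|_{\mathrm{ces}(q)}=\|C(|x|)\|_q$, and let $d(q)=\{x\in\ell_\infty:\hat x\in\ell_q\}$, where $\hat x=(\sup_{k\ge n}|x_k|)_n$, with norm $\|x\|_{d(q)}=\|\hat x\|_q$. For $E\in\{\mathrm{ces},d\}$ let $E(p+)=\bigcap_{p<q<\infty}E(q)$ for $1\le p<\infty$, with the Fréchet topology given by the norms $\|\cdot\|_{E(q)}$, $p<q<\infty$, and let $E(p-)=\bigcup_{1<q<p}E(q)$ for $1<p\le\infty$, with the locally convex inductive limit topology of the Banach spaces $E(q)$, $1<q<p$. A linear subspace $X\subseteq\mathbb C^{\mathbb N}$ is solid if $x\in X$, $y\in\mathbb C^{\mathbb N}$ and $|y|\le|x|$ coordinatewise imply $y\in X$; for a linear subspace $Y\subseteq\mathbb C^{\mathbb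 N}$, $[C,Y]_s$ denotes the largest solid linear subspace $X\subseteq\mathbb C^{\mathbb N}$ with $C(X)\subseteq Y$ (if it exists). (i) (a) For all $1\le p\le q<\infty$, $C$ maps $d(p+)$ into $d(q+)$ and $\mathrm{ces}(p+)$ into $d(q+)$, and both operators $C:d(p+)\to d(q+)$ and $C:\mathrm{ces}(p+)\to d(q+)$ are continuous. (b) For all $1\le p<\infty$ and $x\in\mathbb C^{\mathbb N}$: $C^2(|x|)\in d(p+)$ if and only if $C(|x|)\in d(p+)$. (c) For all $1\le p<\infty$, $[C,d(p+)]_s$ exists and equals $\mathrm{ces}(p+)$. (ii) (a) For all $1<p\le q\le\infty$, $C$ maps $d(p-)$ into $d(q-)$ and $\mathrm{ces}(p-)$ into $d(q-)$, and both operators $C:d(p-)\to d(q-)$ and $C:\mathrm{ces}(p-)\to d(q-)$ are continuous. (b) For all $1<p\le\infty$ and $x\in\mathbb C^{\mathbb N}$: $C^2(|x|)\in d(p-)$ if and only if $C(|x|)\in d(p-)$. (c) For all $1<p\le\infty$, $[C,d(p-)]_s$ exists and equals $\mathrm{ces}(p-)$. -/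

import Mathlib

open scoped ENNReal

noncomputable section

namespace CesaroScale

/-- The vector space `ℂ^ℕ` of all complex sequences; the `n`-th term (`n ≥ 1`) of a sequence is
stored at index `n - 1`. -/
abbrev CSeq : Type := ℕ → ℂ

/-- The Cesàro operator `x ↦ ((x_1 + ⋯ + x_n) / n)_{n ≥ 1}` on `ℂ^ℕ` (with indices shifted by one). -/
def cesaro : CSeq →ₗ[ℂ] CSeq where
  toFun x n := (∑ k ∈ Finset.range (n + 1), x k) / ((n : ℂ) + 1)
  map_add' x y := by
    funext n
    simp [Finset.sum_add_distrib, add_div]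
  map_smul' c x := by
    funext n
    simp [← Finset.mul_sum, mul_div_assoc]

/-- The coordinatewise modulus `|x|`. -/
def modulus (x : CSeq) : CSeq := fun n => ((‖x n‖ : ℝ) : ℂ)

/-- The least decreasing majorant `x̂_n = sup_{k ≥ n} |x_k|` (used for bounded `x` only). -/
def hat (x : CSeq) : ℕ → ℝ := fun n => ⨆ k : ℕ, ‖x (n + k)‖

/-- The exponents `1 < q < ∞`. -/
abbrev Exponent : Type := {q : ℝ≥0∞ // 1 < q ∧ q < ∞}

instance (q : Exponent) : Fact (1 ≤ q.1) := ⟨q.2.1.le⟩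

theorem norm_cesaro_modulus (x : CSeq) (n : ℕ) :
    ‖cesaro (modulus x) n‖ = (∑ k ∈ Finset.range (n + 1), ‖x k‖) / ((n : ℝ) + 1) := by
  have h : cesaro (modulus x) n =
      (((∑ k ∈ Finset.range (n + 1), ‖x k‖) / ((n : ℝ) + 1) : ℝ) : ℂ) := by
    simp [cesaro, modulus]
  rw [h, Complex.norm_real, Real.norm_of_nonneg]
  positivity

theorem norm_cesaro_modulus_add_le (x y : CSeq) (n : ℕ) :
    ‖cesaro (modulus (x + y)) n‖ ≤ ‖(cesaro (modulus x) + cesaro (modulus y)) n‖ := by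
  have h : (cesaro (modulus x) + cesaro (modulus y)) n =
      (((∑ k ∈ Finset.range (n + 1), ‖x k‖) / ((n : ℝ) + 1) +
        (∑ k ∈ Finset.range (n + 1), ‖y k‖) / ((n : ℝ) + 1) : ℝ) : ℂ) := by
    simp [cesaro, modulus]
  rw [h, Complex.norm_real, Real.norm_of_nonneg (by positivity), norm_cesaro_modulus, ← add_div,
    ← Finset.sum_add_distrib]
  gcongr
  exact norm_add_le _ _

theorem norm_cesaro_modulus_smul (c : ℂ) (x : CSeq) (n : ℕ) :
    ‖cesaro (modulus (c • x)) n‖ = ‖(c • cesaro (modulus x)) n‖ := by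
  rw [norm_cesaro_modulus, Pi.smul_apply, norm_smul, norm_cesaro_modulus]
  simp [← Finset.mul_sum, mul_div_assoc]

/-- `ces(q) = {x : C(|x|) ∈ ℓ_q}`. -/
def ces (q : Exponent) : Submodule ℂ CSeq where
  carrier := {x | Memℓp (cesaro (modulus x)) q.1}
  add_mem' {x y} hx hy := Memℓp.mono' (hx.add hy) (norm_cesaro_modulus_add_le x y)
  zero_mem' := Memℓp.mono' (zero_memℓp (E := fun _ : ℕ => ℂ)) fun n => by
    rw [norm_cesaro_modulus]; simp
  smul_mem' c x hx :=
    Memℓp.mono' (Memℓp.const_smul hx c) fun n => (norm_cesaro_modulus_smul c x n).le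

/-- The sequence `C(|x|)`, as an element of `ℓ_q`, of a sequence `x` in `ces(q)`. -/
def cesLp (q : Exponent) (x : ces q) : lp (fun _ : ℕ => ℂ) q.1 := ⟨cesaro (modulus x.1), x.2⟩

theorem norm_cesLp_add_le (q : Exponent) (x y : ces q) :
    ‖cesLp q (x + y)‖ ≤ ‖cesLp q x‖ + ‖cesLp q y‖ := by
  have h : ‖cesLp q (x + y)‖ ≤ ‖cesLp q x + cesLp q y‖ :=
    lp.norm_mono (zero_lt_one.trans q.2.1).ne' fun n => norm_cesaro_modulus_add_le x.1 y.1 n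
  exact h.trans (norm_add_le _ _)

theorem norm_cesLp_smul (q : Exponent) (c : ℂ) (x : ces q) :
    ‖cesLp q (c • x)‖ = ‖c‖ * ‖cesLp q x‖ := by
  have h0 := (zero_lt_one.trans q.2.1).ne'
  have h : ‖cesLp q (c • x)‖ = ‖c • cesLp q x‖ := le_antisymm
    (lp.norm_mono h0 fun n => (norm_cesaro_modulus_smul c x.1 n).le)
    (lp.norm_mono h0 fun n => (norm_cesaro_modulus_smul c x.1 n).ge)
  rw [h, norm_smul]

/-- The norm `‖x‖_{ces(q)} = ‖C(|x|)‖_q` of `ces(q)`. -/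
def cesNorm (q : Exponent) : Seminorm ℂ (ces q) :=
  Seminorm.of (fun x => ‖cesLp q x‖) (norm_cesLp_add_le q) (norm_cesLp_smul q)

theorem hat_nonneg (x : CSeq) (n : ℕ) : 0 ≤ hat x n := Real.iSup_nonneg fun _ => norm_nonneg _

theorem norm_le_hat {x : CSeq} (hx : Memℓp x ∞) (n k : ℕ) : ‖x (n + k)‖ ≤ hat x n := by
  refine le_ciSup (f := fun k => ‖x (n + k)‖) ?_ k
  obtain ⟨M, hM⟩ := memℓp_infty_iff.1 hx
  exact ⟨M, by rintro _ ⟨j, rfl⟩; exact hM ⟨n + j, rfl⟩⟩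

theorem norm_hat_add_le {x y : CSeq} (hx : Memℓp x ∞) (hy : Memℓp y ∞) (n : ℕ) :
    ‖hat (x + y) n‖ ≤ ‖(hat x + hat y) n‖ := by
  rw [Pi.add_apply, Real.norm_of_nonneg (hat_nonneg _ _),
    Real.norm_of_nonneg (add_nonneg (hat_nonneg _ _) (hat_nonneg _ _))]
  exact ciSup_le fun k =>
    (norm_add_le _ _).trans (add_le_add (norm_le_hat hx n k) (norm_le_hat hy n k))

theorem hat_smul (c : ℂ) (x : CSeq) : hat (c • x) = ‖c‖ • hat x := by
  funext n
  simp [hat, Real.mul_iSup_of_nonneg (norm_nonneg c)]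

/-- `d(q) = {x ∈ ℓ_∞ : x̂ ∈ ℓ_q}`. -/
def d (q : Exponent) : Submodule ℂ CSeq where
  carrier := {x | Memℓp x ∞ ∧ Memℓp (hat x) q.1}
  add_mem' {x y} hx hy :=
    ⟨hx.1.add hy.1, Memℓp.mono' (hx.2.add hy.2) (norm_hat_add_le hx.1 hy.1)⟩
  zero_mem' := ⟨zero_memℓp, Memℓp.mono' (zero_memℓp (E := fun _ : ℕ => ℝ)) fun n => by simp [hat]⟩
  smul_mem' c x hx := ⟨hx.1.const_smul c, by rw [hat_smul]; exact hx.2.const_smul ‖c‖⟩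

/-- The sequence `x̂`, as an element of `ℓ_q`, of a sequence `x` in `d(q)`. -/
def dLp (q : Exponent) (x : d q) : lp (fun _ : ℕ => ℝ) q.1 := ⟨hat x.1, x.2.2⟩

theorem norm_dLp_add_le (q : Exponent) (x y : d q) :
    ‖dLp q (x + y)‖ ≤ ‖dLp q x‖ + ‖dLp q y‖ := by
  have h : ‖dLp q (x + y)‖ ≤ ‖dLp q x + dLp q y‖ :=
    lp.norm_mono (zero_lt_one.trans q.2.1).ne' fun n => norm_hat_add_le x.2.1 y.2.1 n
  exact h.trans (norm_add_le _ _)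

theorem norm_dLp_smul (q : Exponent) (c : ℂ) (x : d q) :
    ‖dLp q (c • x)‖ = ‖c‖ * ‖dLp q x‖ := by
  have h : dLp q (c • x) = ‖c‖ • dLp q x := lp.ext (hat_smul c x.1)
  rw [h, norm_smul, norm_norm]

/-- The norm `‖x‖_{d(q)} = ‖x̂‖_q` of `d(q)`. -/
def dNorm (q : Exponent) : Seminorm ℂ (d q) :=
  Seminorm.of (fun x => ‖dLp q x‖) (norm_dLp_add_le q) (norm_dLp_smul q)

/-- A scale of (semi)normed sequence spaces `E(q)`, `1 < q < ∞`, increasing in `q`. It only serves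
to define `E(p+)` and `E(p-)` at once for the two scales `ces` and `d`. -/
structure Scale where
  space : Exponent → Submodule ℂ CSeq
  norm : ∀ q, Seminorm ℂ (space q)
  mono : Monotone space

/-- The scale of the spaces `ces(q)`. -/
def cesScale : Scale where
  space := ces
  norm := cesNorm
  mono _ _ h _ hx := Memℓp.of_exponent_ge hx h

/-- The scale of the spaces `d(q)`. -/
def dScale : Scale where
  space := d
  norm := dNorm
  mono _ _ h _ hx := ⟨hx.1, Memℓp.of_exponent_ge hx.2 h⟩

namespace Scale

variable (E : Scale)

/-- The norm topology of the space `E(q)`. -/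
abbrev normTopology (q : Exponent) : TopologicalSpace (E.space q) :=
  (E.norm q).toSeminormedAddCommGroup.toUniformSpace.toTopologicalSpace

/-- `E(p+) = ⋂_{p < q < ∞} E(q)`, for `1 ≤ p < ∞`. -/
def plus (p : ℝ≥0∞) : Submodule ℂ CSeq where
  carrier := {x | ∀ q : Exponent, p < q.1 → x ∈ E.space q}
  add_mem' hx hy q hq := add_mem (hx q hq) (hy q hq)
  zero_mem' _ _ := zero_mem _
  smul_mem' c _ hx q hq := Submodule.smul_mem _ c (hx q hq)

theorem plus_le {p : ℝ≥0∞} (q : Exponent) (hq : p < q.1) : E.plus p ≤ E.space q :=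
  fun _ hx => hx q hq

/-- The topology of `E(p+)` given by all the norms of the spaces `E(q)`, `p < q < ∞`. -/
abbrev plusTopology (p : ℝ≥0∞) : TopologicalSpace (E.plus p) :=
  ⨅ (q : Exponent) (hq : p < q.1),
    (E.normTopology q).induced (Submodule.inclusion (E.plus_le q hq))

/-- `E(p-) = ⋃_{1 < q < p} E(q)`, for `1 < p ≤ ∞`. (The alternative `x = 0` only matters for `p ≤ 1`,
where the union is empty.) -/
def minus (p : ℝ≥0∞) : Submodule ℂ CSeq where
  carrier := {x | x = 0 ∨ ∃ q : Exponent, q.1 < p ∧ x ∈ E.space q}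
  add_mem' {x y} := by
    rintro (rfl | ⟨q, hq, hx⟩) (rfl | ⟨r, hr, hy⟩)
    · simp
    · exact Or.inr ⟨r, hr, by simpa using hy⟩
    · exact Or.inr ⟨q, hq, by simpa using hx⟩
    · rcases le_total q r with h | h
      · exact Or.inr ⟨r, hr, add_mem (E.mono h hx) hy⟩
      · exact Or.inr ⟨q, hq, add_mem hx (E.mono h hy)⟩
  zero_mem' := Or.inl rfl
  smul_mem' c x := by
    rintro (rfl | ⟨q, hq, hx⟩)
    · simp
    · exact Or.inr ⟨q, hq, Submodule.smul_mem _ c hx⟩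

theorem le_minus {p : ℝ≥0∞} (q : Exponent) (hq : q.1 < p) : E.space q ≤ E.minus p :=
  fun _ hx => Or.inr ⟨q, hq, hx⟩

theorem mem_minus {p : ℝ≥0∞} (hp : 1 < p) {x : CSeq} :
    x ∈ E.minus p ↔ ∃ q : Exponent, q.1 < p ∧ x ∈ E.space q := by
  refine ⟨?_, Or.inr⟩
  rintro (rfl | h)
  · obtain ⟨q, h1, h2⟩ := exists_between hp
    exact ⟨⟨q, h1, h2.trans_le le_top⟩, h2, zero_mem _⟩
  · exact h

/-- The (locally convex) inductive limit topology of `E(p-)`: the finest locally convex vector space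
topology for which all inclusions `E(q) → E(p-)`, `1 < q < p`, are continuous. -/
abbrev minusTopology (p : ℝ≥0∞) : TopologicalSpace (E.minus p) :=
  sInf {t | @IsTopologicalAddGroup (E.minus p) t _ ∧
    @ContinuousSMul ℂ (E.minus p) _ _ t ∧
    @LocallyConvexSpace ℝ (E.minus p) _ _ _ _ t ∧
    ∀ (q : Exponent) (hq : q.1 < p),
      @Continuous _ _ (E.normTopology q) t (Submodule.inclusion (E.le_minus q hq))}

end Scale

/-- The Cesàro operator maps `X` into `Y`, and is continuous as a map from `X` to `Y` for the given
topologies. -/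
def CesaroContinuous (X Y : Submodule ℂ CSeq) (tX : TopologicalSpace X) (tY : TopologicalSpace Y) :
    Prop :=
  ∃ h : ∀ x ∈ X, cesaro x ∈ Y, @Continuous X Y tX tY (cesaro.restrict h)

/-- A linear subspace `X` of `ℂ^ℕ` is solid if `x ∈ X` and `|y| ≤ |x|` imply `y ∈ X`. -/
def IsSolid (X : Submodule ℂ CSeq) : Prop :=
  ∀ x ∈ X, ∀ y : CSeq, (∀ n, ‖y n‖ ≤ ‖x n‖) → y ∈ X

/-- `X = [C, Y]_s`, i.e. `X` is the largest solid linear subspace of `ℂ^ℕ` that the Cesàro operator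
maps into `Y`. -/
def IsLargestSolidDomain (Y X : Submodule ℂ CSeq) : Prop :=
  IsGreatest {Z : Submodule ℂ CSeq | IsSolid Z ∧ ∀ x ∈ Z, cesaro x ∈ Y} X

end CesaroScale

end

open CesaroScale

/-!
Write `A = C(|x|)`, indexed from `0`. Since `(n + 1) A_n` is increasing, `A_n ≤ 2 A_m` for
`n ≤ m ≤ 2n`. Averaging `A_m ^ q` over such blocks gives
`A_j ^ q ≤ 2 ^ (q + 1) ∑_{m ≥ n} A_m ^ q / (m + 1)` for all `j ≥ n`, and the right-hand side has sum
`2 ^ (q + 1) ‖A‖_q ^ q` over `n`. So the least decreasing majorant of `A` is in `ℓ_q` if `A` is: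
`C` maps `ces(q)` boundedly into `d(q)`, and `C(|x|) ∈ d(q)` if and only if `x ∈ ces(q)`. The Hardy
inequality gives the bounded inclusion `d(q) ⊆ ces(q)`. Averaging `A_m` itself over the blocks gives
`A_n ≤ 4 (C A)_{2n}`, so that `C(|x|) ∈ ces(q)` forces `x ∈ ces(q)`. All this is for a single
exponent `q` and passes to `E(p+)` and `E(p-)`.
-/

namespace CesaroScale

section Average

/-- The Cesàro operator on real sequences; it is applied to the sequences of moduli. -/
noncomputable def average (a : ℕ → ℝ) (n : ℕ) : ℝ :=
  (∑ k ∈ Finset.range (n + 1), a k) / ((n : ℝ) + 1)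

variable {a : ℕ → ℝ}

theorem average_nonneg (ha : 0 ≤ a) (n : ℕ) : 0 ≤ average a n :=
  div_nonneg (Finset.sum_nonneg fun k _ => ha k) (by positivity)

theorem average_mono : Monotone average := fun a b hab n => by
  unfold average
  gcongr with k
  exact hab k

theorem succ_mul_average (a : ℕ → ℝ) (n : ℕ) :
    ((n : ℝ) + 1) * average a n = ∑ k ∈ Finset.range (n + 1), a k :=
  mul_div_cancel₀ _ (by positivity)

theorem succ_mul_average_eq_add (a : ℕ → ℝ) (n : ℕ) :
    ((n : ℝ) + 1) * average a n = n * average a (n - 1) + a n := by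
  rw [succ_mul_average, Finset.sum_range_succ]
  rcases n with _ | n
  · simp
  · rw [Nat.add_sub_cancel, Nat.cast_succ, succ_mul_average]

theorem average_le_two_mul_average (ha : 0 ≤ a) {n m : ℕ} (hnm : n ≤ m) (hm : m ≤ 2 * n) :
    average a n ≤ 2 * average a m := by
  have hm' : (m : ℝ) ≤ 2 * n := by exact_mod_cast hm
  refine le_of_mul_le_mul_left ?_ (by positivity : (0 : ℝ) < n + 1)
  calc ((n : ℝ) + 1) * average a n
    _ ≤ (m + 1) * average a m := by
      rw [succ_mul_average, succ_mul_average]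
      exact Finset.sum_le_sum_of_subset_of_nonneg (Finset.range_mono (by lia)) fun k _ _ => ha k
    _ ≤ (2 * (n + 1)) * average a m :=
      mul_le_mul_of_nonneg_right (by linarith) (average_nonneg ha m)
    _ = (n + 1) * (2 * average a m) := by ring

end Average

section Hardy

variable {a : ℕ → ℝ} {s : ℝ}

theorem rpow_sub_one_mul_self {x : ℝ} (hs : 0 < s) (hx : 0 ≤ x) : x ^ (s - 1) * x = x ^ s := by
  rw [← Real.rpow_add_one' hx (by linarith), sub_add_cancel]

theorem mul_rpow_sub_one_mul_le {x y : ℝ} (hs : 1 < s) (hx : 0 ≤ x) (hy : 0 ≤ y) :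
    s * (x ^ (s - 1) * y) ≤ (s - 1) * x ^ s + y ^ s := by
  have hs1 : 0 < s - 1 := sub_pos.2 hs
  calc s * (x ^ (s - 1) * y)
    _ ≤ s * ((x ^ (s - 1)) ^ (s / (s - 1)) / (s / (s - 1)) + y ^ s / s) := by
      gcongr
      exact Real.young_inequality_of_nonneg (by positivity) hy
        (Real.HolderConjugate.conjExponent hs).symm
    _ = (s - 1) * x ^ s + y ^ s := by
      rw [← Real.rpow_mul hx, mul_div_cancel₀ _ hs1.ne']
      field_simp

theorem sub_one_mul_average_rpow_le (hs : 1 < s) (ha : 0 ≤ a) (n : ℕ) :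
    (s - 1) * average a n ^ s ≤ s * (average a n ^ (s - 1) * a n) -
      (((n : ℝ) + 1) * average a n ^ s - n * average a (n - 1) ^ s) := by
  have young := mul_rpow_sub_one_mul_le hs (average_nonneg ha n) (average_nonneg ha (n - 1))
  have hpow := rpow_sub_one_mul_self (zero_lt_one.trans hs) (average_nonneg ha n)
  have hrec := eq_sub_of_add_eq' (succ_mul_average_eq_add a n).symm
  have hsplit : s * (average a n ^ (s - 1) * a n) = s * (n + 1) * average a n ^ s -
      n * (s * (average a n ^ (s - 1) * average a (n - 1))) := by
    rw [← hpow, hrec]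
    ring
  linarith [mul_le_mul_of_nonneg_left young n.cast_nonneg]

theorem sub_one_mul_sum_average_rpow_le (hs : 1 < s) (ha : 0 ≤ a) (N : ℕ) :
    (s - 1) * ∑ n ∈ Finset.range N, average a n ^ s ≤
      s * ∑ n ∈ Finset.range N, average a n ^ (s - 1) * a n := by
  have htelescope : ∑ n ∈ Finset.range N, (((n : ℝ) + 1) * average a n ^ s -
      n * average a (n - 1) ^ s) = N * average a (N - 1) ^ s := by
    simpa using Finset.sum_range_sub (fun n : ℕ => (n : ℝ) * average a (n - 1) ^ s) N
  have hnonneg : 0 ≤ N * average a (N - 1) ^ s :=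
    mul_nonneg N.cast_nonneg (Real.rpow_nonneg (average_nonneg ha _) s)
  have hsum := Finset.sum_le_sum fun n (_ : n ∈ Finset.range N) =>
    sub_one_mul_average_rpow_le hs ha n
  rw [Finset.sum_sub_distrib, htelescope, ← Finset.mul_sum, ← Finset.mul_sum] at hsum
  linarith

theorem hardy_inequality (hs : 1 < s) (ha : 0 ≤ a) (N : ℕ) :
    ∑ n ∈ Finset.range N, average a n ^ s ≤
      (s / (s - 1)) ^ s * ∑ n ∈ Finset.range N, a n ^ s := by
  have hs0 : 0 < s := zero_lt_one.trans hs
  have hs1 : 0 < s - 1 := sub_pos.2 hs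
  have hconj : (s / (s - 1)).HolderConjugate s := (Real.HolderConjugate.conjExponent hs).symm
  set P := ∑ n ∈ Finset.range N, average a n ^ s
  set Q := ∑ n ∈ Finset.range N, a n ^ s
  have hQ : 0 ≤ Q := Finset.sum_nonneg fun n _ => Real.rpow_nonneg (ha n) s
  have hP : 0 ≤ P := Finset.sum_nonneg fun n _ => Real.rpow_nonneg (average_nonneg ha n) s
  rcases hP.eq_or_lt with hP | hP
  · rw [← hP]
    positivity
  have hmixed : ∑ n ∈ Finset.range N, average a n ^ (s - 1) * a n ≤
      P ^ (1 / (s / (s - 1))) * Q ^ (1 / s) := by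
    refine (Real.inner_le_Lp_mul_Lq_of_nonneg _ hconj
      (fun n _ => Real.rpow_nonneg (average_nonneg ha n) _) fun n _ => ha n).trans_eq ?_
    congr 3 with n
    rw [← Real.rpow_mul (average_nonneg ha n), mul_div_cancel₀ _ hs1.ne']
  have hfactor : P ^ (1 / (s / (s - 1))) * P ^ (1 / s) = P := by
    rw [← Real.rpow_add hP, one_div, one_div, hconj.inv_add_inv_eq_one, Real.rpow_one]
  have hroot : P ^ (1 / s) ≤ s / (s - 1) * Q ^ (1 / s) := by
    refine le_of_mul_le_mul_left ?_ (Real.rpow_pos_of_pos hP (1 / (s / (s - 1))))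
    rw [hfactor, mul_left_comm, div_mul_eq_mul_div, le_div_iff₀ hs1, mul_comm P]
    exact (sub_one_mul_sum_average_rpow_le hs ha N).trans (by gcongr)
  have := Real.rpow_le_rpow (by positivity) hroot hs0.le
  rwa [Real.mul_rpow (by positivity) (by positivity), one_div, Real.rpow_inv_rpow hP.le hs0.ne',
    Real.rpow_inv_rpow hQ hs0.ne'] at this

end Hardy

section Copson

/-- The Copson operator `f ↦ (∑_{m ≥ n} f_m / m)_{n ≥ 1}` (with indices shifted by one), the
transpose of `average`. It produces decreasing majorants whose sum is under control. -/
noncomputable def copson (f : ℕ → ℝ) (n : ℕ) : ℝ :=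
  ∑' m, (Set.Ici n).indicator (fun m : ℕ => f m / ((m : ℝ) + 1)) m

variable {f : ℕ → ℝ}

theorem summable_div_succ (hf : 0 ≤ f) (hsum : Summable f) :
    Summable fun m : ℕ => f m / ((m : ℝ) + 1) :=
  hsum.of_nonneg_of_le (fun m => div_nonneg (hf m) (by positivity))
    fun m => div_le_self (hf m) (by simp)

theorem copson_antitone (hf : 0 ≤ f) (hsum : Summable f) : Antitone (copson f) := fun n j hnj =>
  ((summable_div_succ hf hsum).indicator _).tsum_le_tsum
    (Set.indicator_le_indicator_of_subset (Set.Ici_subset_Ici.2 hnj)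
      fun m => div_nonneg (hf m) (by positivity))
    ((summable_div_succ hf hsum).indicator _)

theorem sum_range_copson_le (hf : 0 ≤ f) (hsum : Summable f) (N : ℕ) :
    ∑ n ∈ Finset.range N, copson f n ≤ ∑' m, f m := by
  have hs (n : ℕ) := (summable_div_succ hf hsum).indicator (Set.Ici n)
  unfold copson
  rw [← Summable.tsum_finsetSum fun n _ => hs n]
  refine (summable_sum fun n _ => hs n).tsum_le_tsum (fun m => ?_) hsum
  have hcard : (((Finset.range N).filter (· ≤ m)).card : ℝ) ≤ m + 1 := by
    refine mod_cast (Finset.card_le_card (t := Finset.range (m + 1)) fun n hn => ?_).trans_eq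
      (Finset.card_range _)
    exact Finset.mem_range_succ_iff.2 (Finset.mem_filter.1 hn).2
  simp only [Set.indicator_apply, Set.mem_Ici]
  rw [← Finset.sum_filter, Finset.sum_const, nsmul_eq_mul]
  calc _ ≤ ((m : ℝ) + 1) * (f m / ((m : ℝ) + 1)) :=
        mul_le_mul_of_nonneg_right hcard (div_nonneg (hf m) (by positivity))
    _ = f m := mul_div_cancel₀ _ (by positivity)

end Copson

section Doubling

variable {f : ℕ → ℝ} {c : ℝ}

theorem succ_mul_le_sum_Ico (h : ∀ n m, n ≤ m → m ≤ 2 * n → f n ≤ c * f m) (n : ℕ) :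
    ((n : ℝ) + 1) * f n ≤ c * ∑ m ∈ Finset.Ico n (2 * n + 1), f m := by
  have hcard : (Finset.Ico n (2 * n + 1)).card = n + 1 := by
    rw [Nat.card_Ico]
    lia
  have := Finset.card_nsmul_le_sum (Finset.Ico n (2 * n + 1)) (fun m => c * f m) (f n)
    fun m hm => h n m (Finset.mem_Ico.1 hm).1 (Nat.le_of_lt_succ (Finset.mem_Ico.1 hm).2)
  rwa [hcard, nsmul_eq_mul, Nat.cast_succ, ← Finset.mul_sum] at this

theorem le_two_mul_copson (hf : 0 ≤ f) (hsum : Summable f) (hc : 0 ≤ c)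
    (h : ∀ n m, n ≤ m → m ≤ 2 * n → f n ≤ c * f m) (n : ℕ) : f n ≤ 2 * c * copson f n := by
  have hblock : ∑ m ∈ Finset.Ico n (2 * n + 1), f m ≤ 2 * ((n : ℝ) + 1) * copson f n := by
    calc ∑ m ∈ Finset.Ico n (2 * n + 1), f m
      _ ≤ ∑ m ∈ Finset.Ico n (2 * n + 1),
          2 * ((n : ℝ) + 1) * (Set.Ici n).indicator (fun m : ℕ => f m / ((m : ℝ) + 1)) m := by
        refine Finset.sum_le_sum fun m hm => ?_
        obtain ⟨hnm, hm⟩ := Finset.mem_Ico.1 hm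
        have hm' : (m : ℝ) + 1 ≤ 2 * (n + 1) := by exact_mod_cast (by lia : m + 1 ≤ 2 * (n + 1))
        rw [Set.indicator_of_mem (Set.mem_Ici.2 hnm), mul_div_assoc', le_div_iff₀ (by positivity),
          mul_comm]
        exact mul_le_mul_of_nonneg_right hm' (hf m)
      _ ≤ 2 * ((n : ℝ) + 1) * copson f n := by
        rw [← Finset.mul_sum]
        gcongr
        exact ((summable_div_succ hf hsum).indicator _).sum_le_tsum _ fun m _ =>
          Set.indicator_nonneg (fun m _ => div_nonneg (hf m) (by positivity)) m
  refine le_of_mul_le_mul_left ?_ (by positivity : (0 : ℝ) < n + 1)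
  calc ((n : ℝ) + 1) * f n
    _ ≤ c * ∑ m ∈ Finset.Ico n (2 * n + 1), f m := succ_mul_le_sum_Ico h n
    _ ≤ c * (2 * ((n : ℝ) + 1) * copson f n) := by gcongr
    _ = (n + 1) * (2 * c * copson f n) := by ring

variable {a : ℕ → ℝ}

theorem average_le_four_mul_average_average (ha : 0 ≤ a) (n : ℕ) :
    average a n ≤ 4 * average (average a) (2 * n) := by
  have hA : 0 ≤ average a := average_nonneg ha
  have hsum : ∑ m ∈ Finset.Ico n (2 * n + 1), average a m ≤
      ∑ m ∈ Finset.range (2 * n + 1), average a m :=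
    Finset.sum_le_sum_of_subset_of_nonneg
      (fun m hm => Finset.mem_range.2 (Finset.mem_Ico.1 hm).2) fun m _ _ => hA m
  rw [← succ_mul_average] at hsum
  have hblock := succ_mul_le_sum_Ico (fun _ _ => average_le_two_mul_average ha) n
  refine le_of_mul_le_mul_left ?_ (by positivity : (0 : ℝ) < n + 1)
  push_cast at hsum
  linarith [average_nonneg hA (2 * n)]

theorem average_rpow_le_copson {s : ℝ} (hs : 1 ≤ s) (ha : 0 ≤ a)
    (hsum : Summable fun n => average a n ^ s) {n j : ℕ} (hnj : n ≤ j) :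
    average a j ^ s ≤ 4 ^ s * copson (fun m => average a m ^ s) n := by
  have hf : 0 ≤ fun m => average a m ^ s := fun m => Real.rpow_nonneg (average_nonneg ha m) s
  have hdoubling (n m : ℕ) (hnm : n ≤ m) (hm : m ≤ 2 * n) :
      average a n ^ s ≤ 2 ^ s * average a m ^ s := by
    rw [← Real.mul_rpow zero_le_two (average_nonneg ha m)]
    exact Real.rpow_le_rpow (average_nonneg ha n) (average_le_two_mul_average ha hnm hm)
      (by linarith)
  have hcopson_nonneg : 0 ≤ copson (fun m => average a m ^ s) n :=
    tsum_nonneg (Set.indicator_nonneg fun m _ => div_nonneg (hf m) (by positivity))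
  have hconst : 2 * (2 : ℝ) ^ s ≤ 4 ^ s := by
    rw [show (4 : ℝ) = 2 * 2 by norm_num, Real.mul_rpow zero_le_two zero_le_two]
    gcongr
    exact Real.self_le_rpow_of_one_le one_le_two hs
  calc average a j ^ s
    _ ≤ 2 * 2 ^ s * copson (fun m => average a m ^ s) j :=
      le_two_mul_copson hf hsum (by positivity) hdoubling j
    _ ≤ 2 * 2 ^ s * copson (fun m => average a m ^ s) n := by
      gcongr
      exact copson_antitone hf hsum hnj
    _ ≤ 4 ^ s * copson (fun m => average a m ^ s) n := by gcongr

end Doubling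

section Moduli

theorem norm_modulus (x : CSeq) (n : ℕ) : ‖modulus x n‖ = ‖x n‖ := by
  simp [modulus]

theorem norm_cesaro_modulus_eq_average (x : CSeq) :
    (fun n => ‖cesaro (modulus x) n‖) = average fun k => ‖x k‖ :=
  funext (norm_cesaro_modulus x)

theorem norm_cesaro_le_norm_cesaro_modulus (x : CSeq) (n : ℕ) :
    ‖cesaro x n‖ ≤ ‖cesaro (modulus x) n‖ := by
  have hnorm : ‖(n : ℂ) + 1‖ = (n : ℝ) + 1 := by
    rw [← Nat.cast_succ, Complex.norm_natCast, Nat.cast_succ]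
  rw [norm_cesaro_modulus, cesaro, LinearMap.coe_mk, AddHom.coe_mk, norm_div, hnorm]
  gcongr
  exact norm_sum_le _ _

theorem modulus_cesaro_modulus (x : CSeq) : modulus (cesaro (modulus x)) = cesaro (modulus x) := by
  funext n
  rw [modulus, norm_cesaro_modulus]
  simp [cesaro, modulus]

theorem norm_le_hat_of_le {x : CSeq} (hx : Memℓp x ∞) {n m : ℕ} (hnm : n ≤ m) :
    ‖x m‖ ≤ hat x n := by
  obtain ⟨k, rfl⟩ := Nat.exists_eq_add_of_le hnm
  exact norm_le_hat hx n k

end Moduli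

section SpacesForOneExponent

theorem Exponent.one_lt_toReal (q : Exponent) : 1 < q.1.toReal := by
  simpa using (ENNReal.toReal_lt_toReal ENNReal.one_ne_top q.2.2.ne).2 q.2.1

theorem Exponent.toReal_pos (q : Exponent) : 0 < q.1.toReal :=
  zero_lt_one.trans q.one_lt_toReal

theorem exists_memℓp_norm_le_of_sum_range_le {G : ℕ → Type*} [∀ n, NormedAddCommGroup (G n)]
    {p : ℝ≥0∞} (hp : 0 < p.toReal) {f : ∀ n, G n} {K : ℝ} (hK : 0 ≤ K)
    (h : ∀ N, ∑ n ∈ Finset.range N, ‖f n‖ ^ p.toReal ≤ K ^ p.toReal) :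
    ∃ hf : Memℓp f p, ‖(⟨f, hf⟩ : lp G p)‖ ≤ K := by
  have hnonneg (n : ℕ) : 0 ≤ ‖f n‖ ^ p.toReal := Real.rpow_nonneg (norm_nonneg _) _
  exact ⟨memℓp_gen (summable_of_sum_range_le hnonneg h),
    lp.norm_le_of_tsum_le hp hK (Real.tsum_le_of_sum_range_le hnonneg h)⟩

theorem mem_ces_iff_summable {q : Exponent} {x : CSeq} :
    x ∈ ces q ↔ Summable fun n => average (fun k => ‖x k‖) n ^ q.1.toReal := by
  rw [← norm_cesaro_modulus_eq_average]
  exact memℓp_gen_iff q.toReal_pos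

theorem cesNorm_rpow (q : Exponent) (x : ces q) :
    cesNorm q x ^ q.1.toReal = ∑' n, average (fun k => ‖x.1 k‖) n ^ q.1.toReal := by
  rw [← norm_cesaro_modulus_eq_average]
  exact lp.norm_rpow_eq_tsum q.toReal_pos (cesLp q x)

theorem isSolid_ces (q : Exponent) : IsSolid (ces q) := fun x hx y hyx =>
  Memℓp.mono' hx fun n => by
    rw [norm_cesaro_modulus, norm_cesaro_modulus]
    exact average_mono hyx n

theorem modulus_mem_ces_iff {q : Exponent} {x : CSeq} : modulus x ∈ ces q ↔ x ∈ ces q :=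
  ⟨fun h => isSolid_ces q _ h x fun n => (norm_modulus x n).ge,
    fun h => isSolid_ces q _ h _ fun n => (norm_modulus x n).le⟩

theorem hat_cesaro_rpow_le {q : Exponent} {x : CSeq} (hx : x ∈ ces q) (n : ℕ) :
    hat (cesaro x) n ^ q.1.toReal ≤
      4 ^ q.1.toReal * copson (fun m => average (fun k => ‖x k‖) m ^ q.1.toReal) n := by
  have hbound (j : ℕ) := average_rpow_le_copson q.one_lt_toReal.le
    (fun k => norm_nonneg (x k)) (mem_ces_iff_summable.1 hx) (Nat.le_add_right n j)
  have hcopson := (Real.rpow_nonneg (average_nonneg (fun k => norm_nonneg (x k)) _) _).trans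
    (hbound 0)
  rw [← Real.le_rpow_inv_iff_of_pos (hat_nonneg _ _) hcopson q.toReal_pos]
  refine ciSup_le fun j => (norm_cesaro_le_norm_cesaro_modulus x _).trans ?_
  rw [Real.le_rpow_inv_iff_of_pos (norm_nonneg _) hcopson q.toReal_pos, norm_cesaro_modulus]
  exact hbound j

theorem exists_cesaro_mem_d_dNorm_le {q : Exponent} (x : ces q) :
    ∃ h : cesaro x.1 ∈ d q, dNorm q ⟨cesaro x.1, h⟩ ≤ 4 * cesNorm q x := by
  have hbounded : Memℓp (cesaro x.1) ∞ :=
    (Memℓp.of_exponent_ge x.2 le_top).mono' (norm_cesaro_le_norm_cesaro_modulus x.1)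
  have hf : 0 ≤ fun n => average (fun k => ‖x.1 k‖) n ^ q.1.toReal := fun n =>
    Real.rpow_nonneg (average_nonneg (fun k => norm_nonneg (x.1 k)) n) _
  obtain ⟨hhat, hle⟩ := exists_memℓp_norm_le_of_sum_range_le q.toReal_pos (f := hat (cesaro x.1))
    (K := 4 * cesNorm q x) (by positivity) fun N => by
      simp only [Real.norm_of_nonneg (hat_nonneg _ _)]
      calc ∑ n ∈ Finset.range N, hat (cesaro x.1) n ^ q.1.toReal
        _ ≤ 4 ^ q.1.toReal * ∑ n ∈ Finset.range N,
            copson (fun m => average (fun k => ‖x.1 k‖) m ^ q.1.toReal) n := by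
          rw [Finset.mul_sum]
          exact Finset.sum_le_sum fun n _ => hat_cesaro_rpow_le x.2 n
        _ ≤ 4 ^ q.1.toReal * cesNorm q x ^ q.1.toReal := by
          rw [cesNorm_rpow]
          gcongr
          exact sum_range_copson_le hf (mem_ces_iff_summable.1 x.2) N
        _ = (4 * cesNorm q x) ^ q.1.toReal :=
          (Real.mul_rpow zero_le_four (apply_nonneg _ _)).symm
  exact ⟨⟨hbounded, hhat⟩, hle⟩

theorem cesaro_mem_d_of_mem_ces {q : Exponent} {x : CSeq} (hx : x ∈ ces q) : cesaro x ∈ d q :=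
  (exists_cesaro_mem_d_dNorm_le ⟨x, hx⟩).1

theorem exists_mem_ces_cesNorm_le {q : Exponent} (x : d q) :
    ∃ h : x.1 ∈ ces q, cesNorm q ⟨x.1, h⟩ ≤ q.1.toReal / (q.1.toReal - 1) * dNorm q x := by
  have hconst : 0 ≤ q.1.toReal / (q.1.toReal - 1) :=
    div_nonneg q.toReal_pos.le (sub_nonneg.2 q.one_lt_toReal.le)
  refine exists_memℓp_norm_le_of_sum_range_le q.toReal_pos (f := cesaro (modulus x.1))
    (mul_nonneg hconst (apply_nonneg _ _)) fun N => ?_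
  calc ∑ n ∈ Finset.range N, ‖cesaro (modulus x.1) n‖ ^ q.1.toReal
    _ ≤ (q.1.toReal / (q.1.toReal - 1)) ^ q.1.toReal *
        ∑ n ∈ Finset.range N, ‖x.1 n‖ ^ q.1.toReal := by
      simp only [norm_cesaro_modulus]
      exact hardy_inequality q.one_lt_toReal (fun n => norm_nonneg (x.1 n)) N
    _ ≤ (q.1.toReal / (q.1.toReal - 1)) ^ q.1.toReal * dNorm q x ^ q.1.toReal := by
      gcongr
      refine (Finset.sum_le_sum fun n _ => ?_).trans
        (lp.sum_rpow_le_norm_rpow q.toReal_pos (dLp q x) (Finset.range N))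
      exact Real.rpow_le_rpow (norm_nonneg _)
        ((norm_le_hat_of_le x.2.1 le_rfl).trans (Real.le_norm_self _)) q.toReal_pos.le
    _ = (q.1.toReal / (q.1.toReal - 1) * dNorm q x) ^ q.1.toReal :=
      (Real.mul_rpow hconst (apply_nonneg _ _)).symm

theorem d_le_ces (q : Exponent) : d q ≤ ces q := fun x hx => (exists_mem_ces_cesNorm_le ⟨x, hx⟩).1

theorem cesaro_mem_d_of_mem_d {q : Exponent} {x : CSeq} (hx : x ∈ d q) : cesaro x ∈ d q :=
  cesaro_mem_d_of_mem_ces (d_le_ces q hx)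

theorem dNorm_cesaro_le {q : Exponent} (x : d q) :
    dNorm q ⟨cesaro x.1, cesaro_mem_d_of_mem_d x.2⟩ ≤
      4 * (q.1.toReal / (q.1.toReal - 1)) * dNorm q x := by
  obtain ⟨hces, hle⟩ := exists_mem_ces_cesNorm_le x
  rw [mul_assoc]
  exact (exists_cesaro_mem_d_dNorm_le ⟨x.1, hces⟩).2.trans (by gcongr)

theorem cesaro_modulus_mem_d_iff {q : Exponent} {x : CSeq} :
    cesaro (modulus x) ∈ d q ↔ x ∈ ces q :=
  ⟨fun h => Memℓp.mono' h.2 fun _ => (norm_le_hat_of_le h.1 le_rfl).trans (Real.le_norm_self _),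
    fun h => cesaro_mem_d_of_mem_ces (modulus_mem_ces_iff.2 h)⟩

theorem cesaro_modulus_mem_ces_iff {q : Exponent} {x : CSeq} :
    cesaro (modulus x) ∈ ces q ↔ x ∈ ces q := by
  refine ⟨fun h => ?_, fun h => d_le_ces q (cesaro_modulus_mem_d_iff.2 h)⟩
  rw [mem_ces_iff_summable, norm_cesaro_modulus_eq_average] at h
  have ha : 0 ≤ fun k => ‖x k‖ := fun k => norm_nonneg (x k)
  have heven : Summable fun n =>
      4 ^ q.1.toReal * average (average fun k => ‖x k‖) (2 * n) ^ q.1.toReal :=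
    (h.comp_injective (mul_right_injective₀ two_ne_zero)).mul_left _
  refine mem_ces_iff_summable.2 (heven.of_nonneg_of_le
    (fun n => Real.rpow_nonneg (average_nonneg ha n) _) fun n => ?_)
  rw [← Real.mul_rpow zero_le_four (average_nonneg (average_nonneg ha) _)]
  exact Real.rpow_le_rpow (average_nonneg ha n) (average_le_four_mul_average_average ha n)
    q.toReal_pos.le

theorem cesaro_cesaro_modulus_mem_d_iff {q : Exponent} {x : CSeq} :
    cesaro (cesaro (modulus x)) ∈ d q ↔ cesaro (modulus x) ∈ d q := by
  rw [← modulus_cesaro_modulus x, cesaro_modulus_mem_d_iff, modulus_cesaro_modulus,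
    cesaro_modulus_mem_ces_iff, cesaro_modulus_mem_d_iff]

end SpacesForOneExponent

section LimitSpaces

open scoped Topology

namespace Scale

variable {E F : Scale} {T : CSeq →ₗ[ℂ] CSeq} {p q : ℝ≥0∞}

theorem continuous_restrict_of_norm_le {q r : Exponent} (hT : ∀ x ∈ E.space q, T x ∈ F.space r)
    {K : ℝ} (hK : ∀ x, F.norm r (T.restrict hT x) ≤ K * E.norm q x) :
    Continuous[E.normTopology q, F.normTopology r] (T.restrict hT) := by
  let _ := (E.norm q).toSeminormedAddCommGroup
  let _ := (F.norm r).toSeminormedAddCommGroup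
  exact AddMonoidHomClass.continuous_of_bound (T.restrict hT) K hK

theorem mem_plus_congr {x y : CSeq} (h : ∀ q, x ∈ E.space q ↔ y ∈ F.space q) :
    x ∈ E.plus p ↔ y ∈ F.plus p :=
  forall₂_congr fun q _ => h q

theorem mem_minus_congr (hp : 1 < p) {x y : CSeq} (h : ∀ q, x ∈ E.space q ↔ y ∈ F.space q) :
    x ∈ E.minus p ↔ y ∈ F.minus p := by
  rw [mem_minus E hp, mem_minus F hp]
  exact exists_congr fun q => and_congr_right fun _ => h q

theorem map_mem_plus (hT : ∀ q, ∀ x ∈ E.space q, T x ∈ F.space q) (hpq : p ≤ q) :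
    ∀ x ∈ E.plus p, T x ∈ F.plus q :=
  fun x hx r hr => hT r x (hx r (hpq.trans_lt hr))

theorem map_mem_minus (hT : ∀ q, ∀ x ∈ E.space q, T x ∈ F.space q) (hpq : p ≤ q) :
    ∀ x ∈ E.minus p, T x ∈ F.minus q := by
  rintro x (rfl | ⟨r, hr, hx⟩)
  · rw [map_zero]
    exact zero_mem _
  · exact F.le_minus r (hr.trans_le hpq) (hT r x hx)

theorem continuous_restrict_plus (hT : ∀ q, ∀ x ∈ E.space q, T x ∈ F.space q)
    (hc : ∀ q, Continuous[E.normTopology q, F.normTopology q] (T.restrict (hT q)))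
    (hpq : p ≤ q) :
    Continuous[E.plusTopology p, F.plusTopology q] (T.restrict (map_mem_plus hT hpq)) := by
  refine continuous_iInf_rng.2 fun r => continuous_iInf_rng.2 fun hr => continuous_induced_rng.2 ?_
  have hpr := hpq.trans_lt hr
  refine continuous_iInf_dom (i := r) (continuous_iInf_dom (i := hpr) ?_)
  let _ := E.normTopology r
  let _ := F.normTopology r
  let _ := (E.normTopology r).induced (Submodule.inclusion (E.plus_le r hpr))
  have hincl : Continuous (Submodule.inclusion (E.plus_le r hpr)) := continuous_induced_dom
  exact (hc r).comp hincl

theorem continuous_restrict_minus (hT : ∀ q, ∀ x ∈ E.space q, T x ∈ F.space q)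
    (hc : ∀ q, Continuous[E.normTopology q, F.normTopology q] (T.restrict (hT q)))
    (hpq : p ≤ q) :
    Continuous[E.minusTopology p, F.minusTopology q] (T.restrict (map_mem_minus hT hpq)) := by
  set S := T.restrict (map_mem_minus hT hpq)
  refine continuous_sInf_rng.2 fun t ⟨_, _, _, hincl⟩ => ?_
  -- The topology induced by `S` from `t` competes in the infimum defining `E.minusTopology p`.
  rw [continuous_iff_le_induced]
  refine sInf_le ⟨topologicalAddGroup_induced S, continuousSMul_induced S,
    LocallyConvexSpace.induced (S.restrictScalars ℝ), fun r hr => continuous_induced_rng.2 ?_⟩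
  let _ := E.normTopology r
  let _ := F.normTopology r
  exact (hincl r (hr.trans_le hpq)).comp (hc r)

theorem isSolid_plus (h : ∀ q, IsSolid (E.space q)) : IsSolid (E.plus p) :=
  fun x hx y hyx q hq => h q x (hx q hq) y hyx

theorem isSolid_minus (h : ∀ q, IsSolid (E.space q)) : IsSolid (E.minus p) := by
  rintro x (rfl | ⟨q, hq, hx⟩) y hyx
  · exact Or.inl (funext fun n => by simpa using hyx n)
  · exact E.le_minus q hq (h q x hx y hyx)

end Scale

theorem isLargestSolidDomain_of_cesaro_modulus_mem {X Y : Submodule ℂ CSeq} (hX : IsSolid X)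
    (hXY : ∀ x ∈ X, cesaro x ∈ Y) (hYX : ∀ x, cesaro (modulus x) ∈ Y → x ∈ X) :
    IsLargestSolidDomain Y X :=
  ⟨⟨hX, hXY⟩, fun _ ⟨hZ, hZY⟩ x hx =>
    hYX x (hZY _ (hZ x hx (modulus x) fun n => (norm_modulus x n).le))⟩

theorem continuous_cesaro_ces_d (q : Exponent) :
    Continuous[cesScale.normTopology q, dScale.normTopology q]
      (cesaro.restrict (p := ces q) (q := d q) fun _ => cesaro_mem_d_of_mem_ces) :=
  Scale.continuous_restrict_of_norm_le (E := cesScale) (F := dScale) _ fun x =>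
    (exists_cesaro_mem_d_dNorm_le x).2

theorem continuous_cesaro_d_d (q : Exponent) :
    Continuous[dScale.normTopology q, dScale.normTopology q]
      (cesaro.restrict (p := d q) (q := d q) fun _ => cesaro_mem_d_of_mem_d) :=
  Scale.continuous_restrict_of_norm_le (E := dScale) (F := dScale) _ dNorm_cesaro_le

end LimitSpaces

end CesaroScale

theorem proposition4p9 :
    ((∀ p q : ℝ≥0∞, 1 ≤ p → p ≤ q → q < ∞ →
        CesaroContinuous (dScale.plus p) (dScale.plus q)
          (dScale.plusTopology p) (dScale.plusTopology q) ∧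
        CesaroContinuous (cesScale.plus p) (dScale.plus q)
          (cesScale.plusTopology p) (dScale.plusTopology q)) ∧
      (∀ p : ℝ≥0∞, 1 ≤ p → p < ∞ → ∀ x : CSeq,
        cesaro (cesaro (modulus x)) ∈ dScale.plus p ↔ cesaro (modulus x) ∈ dScale.plus p) ∧
      (∀ p : ℝ≥0∞, 1 ≤ p → p < ∞ →
        IsLargestSolidDomain (dScale.plus p) (cesScale.plus p))) ∧
    ((∀ p q : ℝ≥0∞, 1 < p → p ≤ q →
        CesaroContinuous (dScale.minus p) (dScale.minus q)
          (dScale.minusTopology p) (dScale.minusTopology q) ∧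
        CesaroContinuous (cesScale.minus p) (dScale.minus q)
          (cesScale.minusTopology p) (dScale.minusTopology q)) ∧
      (∀ p : ℝ≥0∞, 1 < p → ∀ x : CSeq,
        cesaro (cesaro (modulus x)) ∈ dScale.minus p ↔ cesaro (modulus x) ∈ dScale.minus p) ∧
      (∀ p : ℝ≥0∞, 1 < p →
        IsLargestSolidDomain (dScale.minus p) (cesScale.minus p))) := by
  refine ⟨⟨fun p q _ hpq _ => ⟨?_, ?_⟩, fun p _ _ x => ?_, fun p _ _ => ?_⟩,
    ⟨fun p q _ hpq => ⟨?_, ?_⟩, fun p hp x => ?_, fun p hp => ?_⟩⟩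
  · exact ⟨_, Scale.continuous_restrict_plus _ continuous_cesaro_d_d hpq⟩
  · exact ⟨_, Scale.continuous_restrict_plus _ continuous_cesaro_ces_d hpq⟩
  · exact Scale.mem_plus_congr fun _ => cesaro_cesaro_modulus_mem_d_iff
  · exact isLargestSolidDomain_of_cesaro_modulus_mem (Scale.isSolid_plus isSolid_ces)
      (Scale.map_mem_plus (fun _ _ => cesaro_mem_d_of_mem_ces) le_rfl)
      fun x => (Scale.mem_plus_congr fun _ => cesaro_modulus_mem_d_iff).1
  · exact ⟨_, Scale.continuous_restrict_minus _ continuous_cesaro_d_d hpq⟩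
  · exact ⟨_, Scale.continuous_restrict_minus _ continuous_cesaro_ces_d hpq⟩
  · exact Scale.mem_minus_congr hp fun _ => cesaro_cesaro_modulus_mem_d_iff
  · exact isLargestSolidDomain_of_cesaro_modulus_mem (Scale.isSolid_minus isSolid_ces)
      (Scale.map_mem_minus (fun _ _ => cesaro_mem_d_of_mem_ces) le_rfl)
      fun x => (Scale.mem_minus_congr hp fun _ => cesaro_modulus_mem_d_iff).1
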